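/- Let $\mathbb F$ be a finite field and let $K$ be a field of characteristic $0$. Let $\mathrm{Rep}(\mathbb F;K)$ be the category whose objects are all functors (not necessarily additive) from the category of finite-dimensional $\mathbb F$-vector spaces to the category of $K$-modules, and whose morphisms are natural transformations, with its usual (pointwise) abelian structure. Then $\mathrm{Rep}(\mathbb F;K)$ is a semisimple abelian category: every object is a (possibly infinite) direct sum of simple objects, and every short exact sequence splits. -/

import Mathlib

open CategoryTheory CategoryTheory.Limits

universe u v w₁ w₂

/-- The category `Rep(F; K)` of generic representations: all functors (not necessarily additive)
from finite-dimensional `F`-vector spaces to `K`-modules, with natural transformations as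
morphisms. -/
abbrev GenericRep (F : Type u) [Field F] (K : Type v) [CommRing K] :=
  FGModuleCat.{u} F ⥤ ModuleCat.{v} K

/-- An abelian category is semisimple if every object is a (possibly infinite) direct sum of
simple objects, and every short exact sequence splits. The index types of the direct sums
are taken in the universe `v`. -/
structure IsSemisimpleCategory (C : Type w₁) [Category.{w₂} C] [Abelian C] : Prop where
  /-- Every object is the coproduct of a family of simple objects. -/
  exists_isColimit_cofan_simple (X : C) :
    ∃ (ι : Type v) (S : ι → C) (i : ∀ j, S j ⟶ X),
      (∀ j, Simple (S j)) ∧ Nonempty (IsColimit (Cofan.mk X i))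
  /-- Every short exact sequence splits. -/
  nonempty_splitting (S : ShortComplex C) (hS : S.ShortExact) : Nonempty S.Splitting

/-! ### Fibre sums of functionals over a finite field. -/

section FiniteFieldSums

/-! The first half is Kovács' theorem that `A = K[End V]` is semisimple
(`isSemisimpleRing_monoidAlgebra_end`). Filter `A` by the ideals `I_r` spanned by endomorphisms of
rank less than `r`, and let `J` be the Jacobson radical. By induction on `r`, `J` annihilates `I_r`
on both sides. For an idempotent `p` of rank at most `r`, the image of `p J p` in the group algebra
of `GL (range p)` vanishes by Maschke, so `p J p` lies in `I_r ∩ J`; this is zero because `I_r` has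
a right identity. To pass from `p J p = 0` to `J p = p J = 0`, use a nondegenerate symmetric form
`λ` on `A` built from the trace: `λ (j p y) = λ (p (y j) p) = 0`. Reaching the identity endomorphism
gives `J = 0`.

The second half transfers this to functors. The ideal of singular endomorphisms of `F^n` has a
two-sided identity `e`; put `ε_n = 1 - e`. Then `ε_m f ε_n = 0` unless `f : F^n → F^m` is an
isomorphism, so different dimensions decouple, and inclusions of subfunctors can be tested on the
parts `ε_n X(F^n)`. A subfunctor `Y` therefore has a complement, assembled from `End`-stable
complements of each `Y(F^n)`. Complements split short exact sequences and, the lattice of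
subfunctors being modular and compactly generated, decompose every functor into simple ones. -/

lemma LinearMap.card_ker_mul_card_of_ne_zero {F E : Type*} [Field F] [AddCommGroup E] [Module F E]
    {l : E →ₗ[F] F} (hl : l ≠ 0) :
    Nat.card (LinearMap.ker l) * Nat.card F = Nat.card E := by
  rw [(LinearMap.ker l).card_eq_card_quotient_mul_card,
    Nat.card_congr (l.quotKerEquivOfSurjective (LinearMap.surjective hl)).toEquiv]

/-- A function on a finite vector space whose sums over the fibres of all functionals
`B · g` vanish is zero. -/
lemma eq_zero_of_forall_sum_fiber_eq_zero {F E E' K : Type*} [Field F] [Finite F]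
    [AddCommGroup E] [Module F E] [Fintype E] [AddCommGroup E'] [Module F E'] [Finite E']
    [Field K] [CharZero K] [DecidableEq F]
    (B : E →ₗ[F] E' →ₗ[F] F) (hB : ∀ x, B x = 0 → x = 0) (h : E → K)
    (H : ∀ g t, ∑ x, (if B x g = t then h x else 0) = 0) : h = 0 := by
  classical
  have := Fintype.ofFinite E'
  have hsum : ∑ x, h x = 0 := by simpa using H 0 0
  funext y
  -- Sum over `g` the fibre sum through `y`. The term `h x` occurs once for each `g` with `B (x - y)
  -- g = 0`: for all of `E'` if `x = y`, for one part in `|F|` otherwise. Since `h` has total sum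
  -- zero, multiplying by `|F|` leaves only `(|F| - 1) |E'| h y`.
  have h1 : ∑ g, ∑ x, (if B x g = B y g then h x else 0) = 0 :=
    Finset.sum_eq_zero fun g _ => H g _
  rw [Finset.sum_comm] at h1
  have h2 : ∀ x, ∑ g, (if B x g = B y g then h x else 0) =
      (Nat.card (LinearMap.ker (B (x - y))) : K) * h x := by
    intro x
    rw [← Finset.sum_filter, Finset.sum_const, nsmul_eq_mul, Nat.card_eq_fintype_card,
      Fintype.card_subtype]
    congr 3
    ext g
    simp [sub_eq_zero]
  have hq : (Nat.card F : K) ≠ 0 := Nat.cast_ne_zero.2 Nat.card_pos.ne'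
  have h3 : ∀ x, (Nat.card F : K) * ((Nat.card (LinearMap.ker (B (x - y))) : K) * h x) =
      (Nat.card E' : K) * h x +
        if x = y then ((Nat.card F : K) - 1) * (Nat.card E' : K) * h x else 0 := by
    intro x
    split_ifs with hx
    · subst hx
      have : Nat.card (LinearMap.ker (B (x - x))) = Nat.card E' := by
        rw [sub_self, map_zero, LinearMap.ker_zero]
        exact Nat.card_congr (Submodule.topEquiv (R := F)).toEquiv
      rw [this]; ring
    · have := LinearMap.card_ker_mul_card_of_ne_zero
        (l := B (x - y)) fun h0 => hx (sub_eq_zero.1 (hB _ h0))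
      rw [← this]; push_cast; ring
  have h4 : ∑ x, (Nat.card F : K) * ((Nat.card (LinearMap.ker (B (x - y))) : K) * h x) = 0 := by
    rw [← Finset.mul_sum, ← Finset.sum_congr rfl fun x _ => h2 x, h1, mul_zero]
  rw [Finset.sum_congr rfl fun x _ => h3 x, Finset.sum_add_distrib, ← Finset.mul_sum, hsum,
    mul_zero, zero_add, Finset.sum_ite_eq' Finset.univ y, if_pos (Finset.mem_univ y)] at h4
  have hq1 : (Nat.card F : K) - 1 ≠ 0 := by
    rw [sub_ne_zero, Ne, Nat.cast_eq_one]
    exact Finite.one_lt_card.ne'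
  have hE : (Nat.card E' : K) ≠ 0 := Nat.cast_ne_zero.2 Nat.card_pos.ne'
  simpa [hq1, hE] using h4

/-- The function on a field with value `1` at `0`, `-1` at `1`, and `0` elsewhere. -/
def zeroMinusOne (F K : Type*) [Field F] [DecidableEq F] [Field K] (t : F) : K :=
  (if t = 0 then 1 else 0) - (if t = 1 then 1 else 0)

/-- `zeroMinusOne` plays the role of a nontrivial additive character without requiring roots of
unity in `K`. The hypothesis equates the fibre sums over `0` and `1`; rescaling `g` then equates all
fibre sums of `g`, and these add up to the total sum, which is zero. -/
lemma eq_zero_of_forall_sum_zeroMinusOne {F E E' K : Type*} [Field F] [Finite F]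
    [AddCommGroup E] [Module F E] [Fintype E] [AddCommGroup E'] [Module F E'] [Finite E']
    [Field K] [CharZero K] [DecidableEq F]
    (B : E →ₗ[F] E' →ₗ[F] F) (hB : ∀ x, B x = 0 → x = 0) (h : E → K)
    (H : ∀ g, ∑ x, h x * zeroMinusOne F K (B x g) = 0) : h = 0 := by
  have := Fintype.ofFinite F
  refine eq_zero_of_forall_sum_fiber_eq_zero B hB h ?_
  have h01 : ∀ g, ∑ x, (if B x g = 0 then h x else 0) = ∑ x, (if B x g = 1 then h x else 0) := by
    intro g
    simpa [zeroMinusOne, mul_sub, sub_eq_zero] using H g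
  -- For `g = 0` the fibre over `0` is everything and the fibre over `1` is empty.
  have hsum : ∑ x, h x = 0 := by simpa using h01 0
  have h0t : ∀ g t, ∑ x, (if B x g = t then h x else 0) =
      ∑ x, (if B x g = 0 then h x else 0) := by
    intro g t
    by_cases ht : t = 0
    · rw [ht]
    · have := (h01 (t⁻¹ • g)).symm
      simpa [ht, inv_mul_eq_iff_eq_mul₀] using this
  intro g t
  have h5 : ∑ t : F, ∑ x, (if B x g = t then h x else 0) = 0 := by
    rw [Finset.sum_comm]; simpa using hsum
  rw [Finset.sum_congr rfl fun t _ => h0t g t, Finset.sum_const, nsmul_eq_mul] at h5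
  rw [h0t]
  refine (mul_eq_zero.1 h5).resolve_left ?_
  simp

end FiniteFieldSums

/-! ### Monoid algebras and the trace form. -/

namespace MonoidAlgebra

/-- The linear extension to a monoid algebra of a function on the monoid. -/
noncomputable def linearExt {K M N : Type*} [CommSemiring K] [AddCommMonoid N] [Module K N]
    (φ : M → N) : MonoidAlgebra K M →ₗ[K] N :=
  Finsupp.linearCombination K φ ∘ₗ (coeffLinearEquiv K).toLinearMap

@[simp]
lemma linearExt_single {K M N : Type*} [CommSemiring K] [AddCommMonoid N] [Module K N]
    (φ : M → N) (m : M) (a : K) : linearExt φ (single m a) = a • φ m := by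
  simp [linearExt, coeffLinearEquiv]

lemma linearExt_apply_eq_sum {K M N : Type*} [CommSemiring K] [AddCommMonoid N] [Module K N]
    [Fintype M] (φ : M → N) (x : MonoidAlgebra K M) :
    linearExt φ x = ∑ m, x.coeff m • φ m := by
  simp [linearExt, coeffLinearEquiv, Finsupp.linearCombination_apply, Finsupp.sum_fintype]

lemma isArtinianRing_of_finite (K M : Type*) [Field K] [Monoid M] [Finite M] :
    IsArtinianRing (MonoidAlgebra K M) :=
  have : Module.Finite K (MonoidAlgebra K M) :=
    Module.Finite.equiv (coeffLinearEquiv (S := K) (M := M) K).symm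
  IsArtinianRing.of_finite K _

end MonoidAlgebra

section TraceForm

open MonoidAlgebra

variable {F V : Type*} [Field F] [DecidableEq F] [AddCommGroup V] [Module F V]
  {K : Type*} [Field K]

/-- The symmetrizing linear form on `K[End V]`. -/
noncomputable def endTrace : MonoidAlgebra K (Module.End F V) →ₗ[K] K :=
  linearExt fun f => zeroMinusOne F K (LinearMap.trace F V f)

lemma endTrace_mul_comm (x y : MonoidAlgebra K (Module.End F V)) :
    endTrace (x * y) = endTrace (y * x) := by
  induction x using MonoidAlgebra.induction_linear with
  | zero => simp
  | add x x' hx hx' => simp [add_mul, mul_add, hx, hx']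
  | single f a =>
    induction y using MonoidAlgebra.induction_linear with
    | zero => simp
    | add x x' hx hx' => simp [add_mul, mul_add, hx, hx']
    | single g b =>
      simp only [endTrace, single_mul_single, linearExt_single, LinearMap.trace_mul_comm F f g,
        mul_comm a b]

/-- Testing on basis elements `g` reduces nondegeneracy of the form to that of the pairing `tr (f
g)`, which is detected by rank-one maps: `tr (f ∘ φ.smulRight w) = φ (f w)`. -/
lemma eq_zero_of_forall_endTrace_mul [Finite F] [Finite V] [CharZero K]
    (x : MonoidAlgebra K (Module.End F V)) (hx : ∀ y, endTrace (x * y) = 0) : x = 0 := by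
  have hfin : Finite (Module.End F V) := DFunLike.finite _
  have := Fintype.ofFinite (Module.End F V)
  have : ⇑x.coeff = 0 := by
    refine eq_zero_of_forall_sum_zeroMinusOne
      ((LinearMap.mul F (Module.End F V)).compr₂ (LinearMap.trace F V)) ?_ _ fun g => ?_
    · intro f hf
      ext w
      by_contra hw
      obtain ⟨φ, hφ⟩ := Module.Projective.exists_dual_ne_zero F hw
      refine hφ ?_
      have h1 := LinearMap.congr_fun hf (φ.smulRight w)
      have h2 : f * φ.smulRight w = φ.smulRight (f w) := by ext; simp
      simpa [h2, LinearMap.trace_smulRight] using h1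
    · have h1 := hx (single g 1)
      have h2 : endTrace (x * single g 1) =
          linearExt (fun f => zeroMinusOne F K (LinearMap.trace F V (f * g))) x := by
        clear h1 hx
        induction x using MonoidAlgebra.induction_linear with
        | zero => simp
        | add x x' hx hx' => simp [add_mul, hx, hx']
        | single f a => simp [endTrace, single_mul_single]
      rw [h2, linearExt_apply_eq_sum] at h1
      simpa using h1
  ext f
  simp [this]

end TraceForm

/-! ### Right identities of left ideals in Artinian rings. -/

section RightIdentity

variable {A : Type*} [Ring A] [IsArtinianRing A]

/-- Modulo the radical the ideal is a direct summand, so the component `e` of `1` is a right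
identity up to an error in the radical. Writing a generator as `a * b` with both factors in the
ideal, the error `a * (b - b * e)` vanishes by `hJ`. -/
lemma exists_right_identity_of_mul_jacobson (s : Set A)
    (hs : ∀ x ∈ s, ∃ a ∈ Ideal.span s, ∃ b ∈ Ideal.span s, a * b = x)
    (hJ : ∀ a ∈ Ideal.span s, ∀ j ∈ Ring.jacobson A, a * j = 0) :
    ∃ e ∈ Ideal.span s, ∀ y ∈ Ideal.span s, y * e = y := by
  have hss : IsSemisimpleModule A (A ⧸ Ring.jacobson A) :=
    (IsArtinian.isSemisimpleModule_iff_jacobson A _).2 (Module.jacobson_quotient_jacobson A A)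
  let q := (Ring.jacobson A).mkQ
  obtain ⟨L, hL⟩ := exists_isCompl (Submodule.map q (Ideal.span s))
  obtain ⟨_, ⟨e, he, rfl⟩, l, hl, hel⟩ := Submodule.mem_sup.1
    (hL.sup_eq_top ▸ Submodule.mem_top : q 1 ∈ _)
  have key : ∀ b ∈ Ideal.span s, b - b * e ∈ Ring.jacobson A := by
    intro b hb
    have h1 : q (b - b * e) = b • l := by
      have : b - b * e = b • (1 - e) := by simp [mul_sub]
      rw [this, map_smul, map_sub, ← hel, add_sub_cancel_left]
    have h2 : q (b - b * e) = 0 := (Submodule.disjoint_def.1 hL.disjoint) _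
      ⟨_, Ideal.sub_mem _ hb (Ideal.mul_mem_left _ _ he), rfl⟩ (h1 ▸ L.smul_mem _ hl)
    exact (Submodule.Quotient.mk_eq_zero _).1 h2
  refine ⟨e, he, fun y hy => ?_⟩
  induction hy using Submodule.span_induction with
  | mem x hx =>
    obtain ⟨a, ha, b, hb, rfl⟩ := hs x hx
    have := hJ a ha _ (key b hb)
    rw [mul_sub, sub_eq_zero] at this
    rw [mul_assoc, ← this]
  | zero => simp
  | add x y _ _ hx hy => rw [add_mul, hx, hy]
  | smul a x _ hx => rw [smul_eq_mul, mul_assoc, hx]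

/-- With `e` the right identity, `y = y * e`, and the radical kills `e` from the left. -/
lemma eq_zero_of_mem_jacobson_of_mem_span (s : Set A)
    (hs : ∀ x ∈ s, ∃ a ∈ Ideal.span s, ∃ b ∈ Ideal.span s, a * b = x)
    (hJ : ∀ a ∈ Ideal.span s, ∀ j ∈ Ring.jacobson A, a * j = 0)
    (hJ' : ∀ a ∈ Ideal.span s, ∀ j ∈ Ring.jacobson A, j * a = 0)
    {y : A} (hy : y ∈ Ring.jacobson A) (hys : y ∈ Ideal.span s) : y = 0 := by
  obtain ⟨e, he, h⟩ := exists_right_identity_of_mul_jacobson s hs hJ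
  rw [← h y hys, hJ' e he y hy]

end RightIdentity

/-! ### Projection to the group algebra of units. -/

namespace MonoidAlgebra

open Classical in
/-- The projection of `K[M]` onto `K[Mˣ]` annihilating the non-units, for a Dedekind-finite
monoid `M`. -/
noncomputable def toUnits (K M : Type*) [CommSemiring K] [Monoid M] [IsDedekindFiniteMonoid M] :
    MonoidAlgebra K M →ₐ[K] MonoidAlgebra K Mˣ :=
  MonoidAlgebra.lift K _ M
    { toFun m := if h : IsUnit m then single h.unit 1 else 0
      map_one' := by
        rw [dif_pos isUnit_one, MonoidAlgebra.one_def]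
        congr 1
        ext; simp
      -- In a Dedekind-finite monoid a product is a unit only if both factors are, so the non-units
      -- span a two-sided ideal.
      map_mul' m n := by
        by_cases hm : IsUnit m
        · by_cases hn : IsUnit n
          · rw [dif_pos (hm.mul hn), dif_pos hm, dif_pos hn, single_mul_single, mul_one]
            congr 1
            ext; simp
          · rw [dif_neg (fun h => hn (IsUnit.mul_iff.1 h).2), dif_neg hn, mul_zero]
        · rw [dif_neg (fun h => hm (IsUnit.mul_iff.1 h).1), dif_neg hm, zero_mul] }

lemma toUnits_single_of_isUnit {K M : Type*} [CommSemiring K] [Monoid M]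
    [IsDedekindFiniteMonoid M] (m : Mˣ) (a : K) :
    toUnits K M (single (m : M) a) = single m a := by
  simp [toUnits, MonoidAlgebra.lift_single]

lemma toUnits_single_of_not_isUnit {K M : Type*} [CommSemiring K] [Monoid M]
    [IsDedekindFiniteMonoid M] {m : M} (hm : ¬ IsUnit m) (a : K) :
    toUnits K M (single m a) = 0 := by
  simp [toUnits, MonoidAlgebra.lift_single, hm]

end MonoidAlgebra

open MonoidAlgebra

/-! ### Idempotents and the rank filtration. -/

section Idempotent

variable {F V W : Type*} [Field F] [AddCommGroup V] [Module F V] [AddCommGroup W] [Module F W]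

/-- A linear map is fixed on the left by an idempotent of the same rank. -/
lemma exists_idempotent_comp_eq (f : V →ₗ[F] W) : ∃ p : Module.End F W,
    p * p = p ∧ p ∘ₗ f = f ∧
      Module.finrank F (LinearMap.range p) = Module.finrank F (LinearMap.range f) := by
  obtain ⟨q, hq⟩ := (LinearMap.range f).subtype.exists_leftInverse_of_injective
    (LinearMap.range f).ker_subtype
  have hq' : ∀ x, q (f x) = ⟨f x, x, rfl⟩ := fun x =>
    LinearMap.congr_fun hq ⟨f x, x, rfl⟩
  refine ⟨(LinearMap.range f).subtype ∘ₗ q, ?_, ?_, ?_⟩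
  · ext x
    exact congrArg Subtype.val (LinearMap.congr_fun hq (q x))
  · ext x
    simp [hq']
  · have hr : LinearMap.range q = ⊤ :=
      LinearMap.range_eq_top.2 fun x => ⟨(x : W), LinearMap.congr_fun hq x⟩
    rw [LinearMap.range_comp, hr, Submodule.map_top, Submodule.range_subtype]

/-- A linear map is fixed on the right by an idempotent of the same rank. -/
lemma exists_comp_idempotent_eq (f : V →ₗ[F] W) : ∃ p : Module.End F V,
    p * p = p ∧ f ∘ₗ p = f ∧
      Module.finrank F (LinearMap.range p) = Module.finrank F (LinearMap.range f) := by
  obtain ⟨s, hs⟩ := f.rangeRestrict.exists_rightInverse_of_surjective f.range_rangeRestrict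
  have hs' : ∀ x, f (s x) = x := fun x => congrArg Subtype.val (LinearMap.congr_fun hs x)
  refine ⟨s ∘ₗ f.rangeRestrict, ?_, ?_, ?_⟩
  · ext x
    have : f.rangeRestrict (s (f.rangeRestrict x)) = f.rangeRestrict x :=
      LinearMap.congr_fun hs _
    simp [this]
  · ext x
    simp [hs']
  · rw [LinearMap.range_comp_of_range_eq_top _ f.range_rangeRestrict]
    exact LinearMap.finrank_range_of_inj fun x y h => Subtype.ext (by rw [← hs' x, h, hs' y])

end Idempotent

section RankIdeal

variable (K F V : Type*) [Field K] [Field F] [AddCommGroup V] [Module F V]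

/-- The basis elements of `K[End V]` of rank less than `r`. -/
def rankLT (r : ℕ) : Set (MonoidAlgebra K (Module.End F V)) :=
  {x | ∃ f : Module.End F V, Module.finrank F (LinearMap.range f) < r ∧ single f 1 = x}

/-- The ideal of `K[End V]` spanned by the endomorphisms of rank less than `r`. -/
noncomputable abbrev rankIdeal (r : ℕ) : Ideal (MonoidAlgebra K (Module.End F V)) :=
  Ideal.span (rankLT K F V r)

variable {K F V}

lemma single_mem_rankIdeal {r : ℕ} {f : Module.End F V}
    (hf : Module.finrank F (LinearMap.range f) < r) (a : K) : single f a ∈ rankIdeal K F V r := by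
  have := Ideal.mul_mem_left _ (single 1 a) (Ideal.subset_span ⟨f, hf, rfl⟩ :
    single f 1 ∈ rankIdeal K F V r)
  simpa [single_mul_single] using this

variable [FiniteDimensional F V]

lemma finrank_range_mul_le_left (f g : Module.End F V) :
    Module.finrank F (LinearMap.range (f * g)) ≤ Module.finrank F (LinearMap.range f) :=
  Submodule.finrank_mono (LinearMap.range_comp_le_range _ _)

lemma mul_mem_rankIdeal {r : ℕ} {x : MonoidAlgebra K (Module.End F V)}
    (hx : x ∈ rankIdeal K F V r) (y) : x * y ∈ rankIdeal K F V r := by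
  induction hx using Submodule.span_induction with
  | mem x hx =>
    obtain ⟨f, hf, rfl⟩ := hx
    induction y using MonoidAlgebra.induction_linear with
    | zero => simp
    | add x x' hx hx' => rw [mul_add]; exact Ideal.add_mem _ hx hx'
    | single g b =>
      rw [single_mul_single]
      exact single_mem_rankIdeal ((finrank_range_mul_le_left f g).trans_lt hf) _
  | zero => simp
  | add x y _ _ hx hy => rw [add_mul]; exact Ideal.add_mem _ hx hy
  | smul a x _ hx => rw [smul_mul_assoc]; exact Ideal.mul_mem_left _ _ hx

omit [FiniteDimensional F V] in
lemma exists_mul_eq_of_mem_rankLT {r : ℕ} : ∀ x ∈ rankLT K F V r,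
    ∃ a ∈ rankIdeal K F V r, ∃ b ∈ rankIdeal K F V r, a * b = x := by
  rintro _ ⟨f, hf, rfl⟩
  obtain ⟨p, -, hpf, hr⟩ := exists_idempotent_comp_eq f
  rw [← Module.End.mul_eq_comp] at hpf
  refine ⟨single p 1, single_mem_rankIdeal (hr ▸ hf) _, single f 1, single_mem_rankIdeal hf _, ?_⟩
  simp [single_mul_single, hpf]

end RankIdeal

/-! ### Corners of `K[End V]` and group algebras of general linear groups. -/

section Corner

variable {K F V : Type*} [Field K] [Field F] [AddCommGroup V] [Module F V]
  [FiniteDimensional F V] (p : Module.End F V)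

/-- Compression of an endomorphism to the range of `p`. -/
noncomputable def compress (f : Module.End F V) : Module.End F (LinearMap.range p) :=
  p.rangeRestrict ∘ₗ f ∘ₗ (LinearMap.range p).subtype

/-- Extension of an endomorphism of the range of `p`. -/
noncomputable def inflate (g : Module.End F (LinearMap.range p)) : Module.End F V :=
  (LinearMap.range p).subtype ∘ₗ g ∘ₗ p.rangeRestrict

omit [FiniteDimensional F V] in
lemma inflate_compress (f : Module.End F V) : inflate p (compress p f) = p * f * p := by
  ext; simp [inflate, compress]

omit [FiniteDimensional F V] in
lemma compress_mul_mul (f g : Module.End F V) :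
    compress p (f * p * g) = compress p f * compress p g := by
  ext; simp [compress]

variable {p}

omit [FiniteDimensional F V] in
lemma idempotent_apply_of_mem (hp : p * p = p) {x : V} (hx : x ∈ LinearMap.range p) : p x = x := by
  obtain ⟨y, rfl⟩ := hx
  exact LinearMap.congr_fun hp y

omit [FiniteDimensional F V] in
lemma compress_inflate (hp : p * p = p) (g : Module.End F (LinearMap.range p)) :
    compress p (inflate p g) = g := by
  ext x
  have : p.rangeRestrict x = x := Subtype.ext (idempotent_apply_of_mem hp x.2)
  simp [compress, inflate, this, idempotent_apply_of_mem hp]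

omit [FiniteDimensional F V] in
lemma compress_one (hp : p * p = p) : compress p 1 = 1 := by
  ext x
  simp [compress, idempotent_apply_of_mem hp]

variable (K p)

/-- The map from `K[End V]` to the group algebra of the general linear group of the range
of `p`, which is multiplicative on the corner of `p`. -/
noncomputable def cornerToUnits : MonoidAlgebra K (Module.End F V) →ₗ[K]
    MonoidAlgebra K (Module.End F (LinearMap.range p))ˣ :=
  (toUnits K _).toLinearMap ∘ₗ linearExt fun f => single (compress p f) 1

/-- The section of `cornerToUnits`. -/
noncomputable def unitsToCorner : MonoidAlgebra K (Module.End F (LinearMap.range p))ˣ →ₗ[K]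
    MonoidAlgebra K (Module.End F V) :=
  linearExt fun g => single (inflate p g) 1

variable {K p}

/-- Compression forgets what leaves the range of `p`; inserting `p` between the factors restores
multiplicativity. -/
lemma cornerToUnits_mul (x y : MonoidAlgebra K (Module.End F V)) :
    cornerToUnits K p (x * single p 1 * y) = cornerToUnits K p x * cornerToUnits K p y := by
  induction x using MonoidAlgebra.induction_linear with
  | zero => simp
  | add x x' hx hx' => simp only [add_mul, map_add, hx, hx']
  | single f a =>
    induction y using MonoidAlgebra.induction_linear with
    | zero => simp
    | add x x' hx hx' => simp only [mul_add, map_add, hx, hx']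
    | single g b =>
      simp only [cornerToUnits, LinearMap.comp_apply, single_mul_single, linearExt_single,
        compress_mul_mul, AlgHom.toLinearMap_apply, ← map_mul, smul_single]
      simp

lemma cornerToUnits_one (hp : p * p = p) : cornerToUnits K p 1 = 1 := by
  simp only [cornerToUnits, LinearMap.comp_apply, MonoidAlgebra.one_def, linearExt_single,
    compress_one hp, one_smul]
  exact map_one (toUnits K _)

lemma cornerToUnits_unitsToCorner (hp : p * p = p) (x) :
    cornerToUnits K p (unitsToCorner K p x) = x := by
  induction x using MonoidAlgebra.induction_linear with
  | zero => simp
  | add x x' hx hx' => simp only [map_add, hx, hx']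
  | single g a =>
    simp [cornerToUnits, unitsToCorner, compress_inflate hp, toUnits_single_of_isUnit]

/-- If the compression of `f` is invertible, inflating it returns `p * f * p` exactly. Otherwise `p
* f * p` factors through a non-surjective endomorphism of the range of `p`, so its rank drops. -/
lemma corner_sub_mem_rankIdeal (x : MonoidAlgebra K (Module.End F V)) :
    single p 1 * x * single p 1 - unitsToCorner K p (cornerToUnits K p x) ∈
      rankIdeal K F V (Module.finrank F (LinearMap.range p)) := by
  induction x using MonoidAlgebra.induction_linear with
  | zero => simp
  | add x x' hx hx' =>
    convert Ideal.add_mem _ hx hx' using 1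
    simp only [mul_add, add_mul, map_add]
    abel
  | single f a =>
    by_cases h : IsUnit (compress p f)
    · obtain ⟨g, hg⟩ := h
      have : single p 1 * single f a * single p 1 -
          unitsToCorner K p (cornerToUnits K p (single f a)) = 0 := by
        simp [cornerToUnits, unitsToCorner, ← hg, toUnits_single_of_isUnit, single_mul_single]
        simp [hg, inflate_compress]
      rw [this]
      exact Ideal.zero_mem _
    · have : single p 1 * single f a * single p 1 -
          unitsToCorner K p (cornerToUnits K p (single f a)) = single (p * f * p) a := by
        simp [cornerToUnits, toUnits_single_of_not_isUnit h, single_mul_single]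
      rw [this]
      refine single_mem_rankIdeal ?_ _
      rw [← inflate_compress, inflate, LinearMap.range_comp]
      refine (Submodule.finrank_map_le _ _).trans_lt ?_
      refine (Submodule.finrank_mono (LinearMap.range_comp_le_range _ _)).trans_lt ?_
      refine Submodule.finrank_lt fun htop => h ?_
      exact LinearMap.isUnit_iff_range_eq_top _ |>.2 htop

/-- By Maschke the target has zero radical, so it is enough to land in that radical. Quasi-inverses
transfer along `cornerToUnits`, although it is not multiplicative everywhere, because the test
element `b` is lifted with a factor `p` on each side. -/
lemma cornerToUnits_eq_zero_of_mem_jacobson [Finite F] [CharZero K] (hp : p * p = p)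
    {x : MonoidAlgebra K (Module.End F V)} (hx : x ∈ Ring.jacobson _) :
    cornerToUnits K p x = 0 := by
  have : Finite V := Module.finite_of_finite F
  have : Finite (Module.End F (LinearMap.range p)) := DFunLike.finite _
  have : Finite (Module.End F (LinearMap.range p))ˣ := inferInstance
  have : NeZero (Nat.card (Module.End F (LinearMap.range p))ˣ : K) :=
    ⟨Nat.cast_ne_zero.2 Nat.card_pos.ne'⟩
  have hss : Ring.jacobson (MonoidAlgebra K (Module.End F (LinearMap.range p))ˣ) = ⊥ :=
    IsSemisimpleRing.jacobson_eq_bot _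
  rw [← Submodule.mem_bot (R := MonoidAlgebra K (Module.End F (LinearMap.range p))ˣ), ← hss,
    ← Ideal.jacobson_bot, Ideal.mem_jacobson_iff]
  intro b
  rw [← Ideal.jacobson_bot, Ideal.mem_jacobson_iff] at hx
  obtain ⟨z, hz⟩ := hx (single p 1 * unitsToCorner K p b * single p 1)
  refine ⟨cornerToUnits K p z, ?_⟩
  rw [Submodule.mem_bot] at hz ⊢
  have := congrArg (cornerToUnits K p) hz
  have h2 : z * (single p 1 * unitsToCorner K p b * single p 1) * x =
      z * single p 1 * unitsToCorner K p b * single p 1 * x := by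
    simp only [mul_assoc]
  rwa [map_sub, map_add, h2, cornerToUnits_mul, cornerToUnits_mul,
    cornerToUnits_unitsToCorner hp, cornerToUnits_one hp, map_zero] at this

end Corner

/-! ### Semisimplicity of `K[End V]` and Kovács' idempotent. -/

section Semisimple

variable {K F V : Type*} [Field K] [CharZero K] [Field F] [Finite F] [AddCommGroup V] [Module F V]
  [FiniteDimensional F V]

omit [CharZero K] [Finite F] [FiniteDimensional F V] in
lemma jacobson_mul_rankIdeal_of_single {r : ℕ}
    (H : ∀ f : Module.End F V, Module.finrank F (LinearMap.range f) < r →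
      ∀ j ∈ Ring.jacobson (MonoidAlgebra K (Module.End F V)),
        j * single f 1 = 0 ∧ single f 1 * j = 0)
    {a : MonoidAlgebra K (Module.End F V)} (ha : a ∈ rankIdeal K F V r) :
    ∀ j ∈ Ring.jacobson (MonoidAlgebra K (Module.End F V)), j * a = 0 ∧ a * j = 0 := by
  induction ha using Submodule.span_induction with
  | mem x hx => obtain ⟨f, hf, rfl⟩ := hx; exact H f hf
  | zero => simp
  | add x y _ _ hx hy =>
    intro j hj
    simp [mul_add, add_mul, hx j hj, hy j hj]
  | smul a x _ hx =>
    intro j hj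
    rw [smul_eq_mul, ← mul_assoc, mul_assoc a]
    exact ⟨(hx _ (Ideal.mul_mem_right _ _ hj)).1, by rw [(hx j hj).2, mul_zero]⟩

/-- The Jacobson radical of `K[End V]` annihilates all endomorphisms on both sides. -/
lemma jacobson_mul_single (r : ℕ) (f : Module.End F V)
    (hf : Module.finrank F (LinearMap.range f) < r) :
    ∀ j ∈ Ring.jacobson (MonoidAlgebra K (Module.End F V)),
      j * single f 1 = 0 ∧ single f 1 * j = 0 := by
  classical
  have : Finite V := Module.finite_of_finite F
  have : Finite (Module.End F V) := DFunLike.finite _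
  have := MonoidAlgebra.isArtinianRing_of_finite K (Module.End F V)
  induction r generalizing f with
  | zero => omega
  | succ r ih =>
    have corner : ∀ p : Module.End F V, p * p = p → Module.finrank F (LinearMap.range p) ≤ r →
        ∀ j ∈ Ring.jacobson (MonoidAlgebra K (Module.End F V)),
          single p 1 * j * single p 1 = 0 := by
      intro p hp hr j hj
      -- `p j p` lies in the radical and, its image in the group algebra being zero, also in the
      -- ideal of rank less than `r`. By the induction hypothesis these two meet in zero.
      refine eq_zero_of_mem_jacobson_of_mem_span (rankLT K F V r) exists_mul_eq_of_mem_rankLT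
        (fun a ha j hj => (jacobson_mul_rankIdeal_of_single ih ha j hj).2)
        (fun a ha j hj => (jacobson_mul_rankIdeal_of_single ih ha j hj).1)
        (Ideal.mul_mem_right _ _ (Ideal.mul_mem_left _ _ hj)) ?_
      have := corner_sub_mem_rankIdeal (p := p) j
      rw [cornerToUnits_eq_zero_of_mem_jacobson hp hj, map_zero, sub_zero] at this
      refine Ideal.span_mono ?_ this
      rintro _ ⟨f, hf, rfl⟩
      exact ⟨f, hf.trans_le hr, rfl⟩
    have hidem : ∀ p : Module.End F V, p * p = p →
        (single p 1 : MonoidAlgebra K (Module.End F V)) = single p 1 * single p 1 := by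
      intro p hp; simp [single_mul_single, hp]
    intro j hj
    constructor
    · obtain ⟨p, hp, hpf, hr⟩ := exists_idempotent_comp_eq f
      rw [← Module.End.mul_eq_comp] at hpf
      -- Symmetry of the form turns `j p y = j p p y` into `p (y j) p`, where `y j` is again in the
      -- radical.
      have h0 : j * single p 1 = 0 := by
        refine eq_zero_of_forall_endTrace_mul (F := F) _ fun y => ?_
        rw [hidem p hp, ← mul_assoc, mul_assoc (j * _), endTrace_mul_comm, mul_assoc,
          ← mul_assoc y, ← mul_assoc, corner p hp (by omega) _ (Ideal.mul_mem_left _ y hj), map_zero]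
      rw [← hpf, ← mul_one (1 : K), ← single_mul_single, ← mul_assoc, h0, zero_mul]
    · obtain ⟨p, hp, hpf, hr⟩ := exists_comp_idempotent_eq f
      rw [← Module.End.mul_eq_comp] at hpf
      have h0 : single p 1 * j = 0 := by
        refine eq_zero_of_forall_endTrace_mul (F := F) _ fun y => ?_
        rw [hidem p hp, mul_assoc, mul_assoc, endTrace_mul_comm, ← mul_assoc,
          mul_assoc (single p 1) j y,
          corner p hp (by omega) _ (Ideal.mul_mem_right y _ hj), map_zero]
      rw [← hpf, ← mul_one (1 : K), ← single_mul_single, mul_assoc, h0, mul_zero]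

variable (K F V)

/-- The monoid algebra of `End V` is semisimple. -/
theorem isSemisimpleRing_monoidAlgebra_end :
    IsSemisimpleRing (MonoidAlgebra K (Module.End F V)) := by
  have : Finite V := Module.finite_of_finite F
  have : Finite (Module.End F V) := DFunLike.finite _
  have := MonoidAlgebra.isArtinianRing_of_finite K (Module.End F V)
  rw [IsArtinianRing.isSemisimpleRing_iff_jacobson, eq_bot_iff]
  intro j hj
  simpa [← MonoidAlgebra.one_def] using (jacobson_mul_single _ 1 (Nat.lt_succ_self _) j hj).1

/-- Kovács' theorem: the ideal of `K[End V]` spanned by the singular endomorphisms has an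
identity `e`; in terms of the complementary idempotent `1 - e`. -/
theorem exists_one_sub_annihilates_singular :
    ∃ e ∈ rankIdeal K F V (Module.finrank F V), ∀ f : Module.End F V,
      Module.finrank F (LinearMap.range f) < Module.finrank F V →
      (1 - e) * single f 1 = 0 ∧ single f 1 * (1 - e) = 0 := by
  classical
  have : Finite V := Module.finite_of_finite F
  have : Finite (Module.End F V) := DFunLike.finite _
  have := MonoidAlgebra.isArtinianRing_of_finite K (Module.End F V)
  have := isSemisimpleRing_monoidAlgebra_end K F V
  obtain ⟨e, he, h⟩ := exists_right_identity_of_mul_jacobson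
    (rankLT K F V (Module.finrank F V)) exists_mul_eq_of_mem_rankLT (by
      intro a _ j hj
      rw [IsSemisimpleRing.jacobson_eq_bot, Submodule.mem_bot] at hj
      rw [hj, mul_zero])
  refine ⟨e, he, fun f hf => ⟨eq_zero_of_forall_endTrace_mul (F := F) _ fun y => ?_, ?_⟩⟩
  -- The right identity is also a left one: by symmetry the form takes the same value on `(1 - e) f
  -- y` and `f y (1 - e)`, and the latter is zero since `f y` lies in the ideal.
  · rw [mul_assoc, endTrace_mul_comm, mul_sub, mul_one,
      h _ (mul_mem_rankIdeal (single_mem_rankIdeal hf _) _), sub_self, map_zero]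
  · rw [mul_sub, mul_one, h _ (single_mem_rankIdeal hf _), sub_self]

end Semisimple

/-! ### The lattice of subfunctors. -/

section SubmoduleFunctor

variable {C : Type w₁} [Category.{w₂} C] {K : Type v} [Ring K]

/-- A subfunctor of a functor to modules: a family of submodules stable under all maps. -/
@[ext]
structure SubmoduleFunctor (X : C ⥤ ModuleCat.{v} K) where
  /-- The submodule at an object. -/
  carrier : ∀ V, Submodule K (X.obj V)
  /-- The submodules are stable under the maps of the functor. -/
  map_mem : ∀ {V W} (f : V ⟶ W) {x}, x ∈ carrier V → (X.map f).hom x ∈ carrier W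

namespace SubmoduleFunctor

variable {X : C ⥤ ModuleCat.{v} K}

lemma carrier_injective :
    Function.Injective (carrier : SubmoduleFunctor X → ∀ V, Submodule K (X.obj V)) :=
  fun _ _ => SubmoduleFunctor.ext

instance : LE (SubmoduleFunctor X) := ⟨fun S T => S.carrier ≤ T.carrier⟩

instance : LT (SubmoduleFunctor X) := ⟨fun S T => S.carrier < T.carrier⟩

lemma le_iff {S T : SubmoduleFunctor X} : S ≤ T ↔ ∀ V, S.carrier V ≤ T.carrier V := Iff.rfl

instance : Max (SubmoduleFunctor X) where
  max S T :=
    { carrier V := S.carrier V ⊔ T.carrier V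
      map_mem {V W} f x hx := by
        obtain ⟨y, hy, z, hz, rfl⟩ := Submodule.mem_sup.1 hx
        rw [map_add]
        exact Submodule.add_mem_sup (S.map_mem f hy) (T.map_mem f hz) }

instance : Min (SubmoduleFunctor X) where
  min S T :=
    { carrier V := S.carrier V ⊓ T.carrier V
      map_mem f _ hx := ⟨S.map_mem f hx.1, T.map_mem f hx.2⟩ }

instance : Top (SubmoduleFunctor X) := ⟨⟨fun _ => ⊤, fun _ _ _ => trivial⟩⟩

instance : Bot (SubmoduleFunctor X) where
  bot :=
    { carrier _ := ⊥
      map_mem f x hx := by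
        rw [Submodule.mem_bot] at hx ⊢
        rw [hx, map_zero] }

instance : SupSet (SubmoduleFunctor X) where
  sSup s :=
    { carrier V := ⨆ S ∈ s, S.carrier V
      map_mem {V W} f x hx := by
        have : ⨆ S ∈ s, S.carrier V ≤
            (⨆ S ∈ s, S.carrier W).comap (X.map f).hom :=
          iSup₂_le fun S hS y hy =>
            (le_iSup₂ (f := fun (S : SubmoduleFunctor X) (_ : S ∈ s) => S.carrier W) S hS)
              (S.map_mem f hy)
        exact this hx }

instance : InfSet (SubmoduleFunctor X) where
  sInf s :=
    { carrier V := ⨅ S ∈ s, S.carrier V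
      map_mem {V W} f x hx := by
        simp only [Submodule.mem_iInf] at hx ⊢
        exact fun S hS => S.map_mem f (hx S hS) }

instance : CompleteLattice (SubmoduleFunctor X) :=
  carrier_injective.completeLattice carrier Iff.rfl Iff.rfl (fun _ _ => rfl) (fun _ _ => rfl)
    (fun s => by funext V; simp only [iSup_apply]; rfl)
    (fun s => by funext V; simp only [iInf_apply]; rfl) rfl rfl

@[simp] lemma carrier_sup (S T : SubmoduleFunctor X) (V : C) :
    (S ⊔ T).carrier V = S.carrier V ⊔ T.carrier V := rfl

@[simp] lemma carrier_inf (S T : SubmoduleFunctor X) (V : C) :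
    (S ⊓ T).carrier V = S.carrier V ⊓ T.carrier V := rfl

@[simp] lemma carrier_top (V : C) : (⊤ : SubmoduleFunctor X).carrier V = ⊤ := rfl

@[simp] lemma carrier_bot (V : C) : (⊥ : SubmoduleFunctor X).carrier V = ⊥ := rfl

lemma carrier_sSup (s : Set (SubmoduleFunctor X)) (V : C) :
    (sSup s).carrier V = ⨆ S ∈ s, S.carrier V := rfl

@[simp] lemma carrier_iSup {ι : Sort*} (S : ι → SubmoduleFunctor X) (V : C) :
    (⨆ i, S i).carrier V = ⨆ i, (S i).carrier V := by
  rw [iSup, carrier_sSup, iSup_range]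

lemma mem_of_le {S T : SubmoduleFunctor X} (h : S ≤ T) {V : C} {x : X.obj V}
    (hx : x ∈ S.carrier V) : x ∈ T.carrier V := h V hx

instance : IsModularLattice (SubmoduleFunctor X) where
  sup_inf_le_assoc_of_le y _ hxz V := IsModularLattice.sup_inf_le_assoc_of_le (y.carrier V) (hxz V)

/-- The subfunctor generated by an element. -/
def gen {V : C} (x : X.obj V) : SubmoduleFunctor X := sInf {S | x ∈ S.carrier V}

lemma gen_le {V : C} {x : X.obj V} {S : SubmoduleFunctor X} : gen x ≤ S ↔ x ∈ S.carrier V := by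
  refine ⟨fun h => mem_of_le h ?_, fun h => sInf_le h⟩
  change x ∈ ⨅ S ∈ {S : SubmoduleFunctor X | x ∈ S.carrier V}, S.carrier V
  simp [Submodule.mem_iInf]

/-- Containing `gen x` is a condition at the single object `V`, where a directed supremum of
submodules is a union. -/
lemma isCompactElement_gen {V : C} (x : X.obj V) : IsCompactElement (gen x) := by
  rw [CompleteLattice.isCompactElement_iff_le_of_directed_sSup_le]
  intro s hne hdir h
  rw [gen_le, carrier_sSup, ← sSup_image] at h
  have hdir' : DirectedOn (· ≤ ·) ((fun S : SubmoduleFunctor X => S.carrier V) '' s) := by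
    rintro _ ⟨S, hS, rfl⟩ _ ⟨T, hT, rfl⟩
    obtain ⟨U, hU, hSU, hTU⟩ := hdir S hS T hT
    exact ⟨_, ⟨U, hU, rfl⟩, hSU V, hTU V⟩
  obtain ⟨_, ⟨S, hS, rfl⟩, hx⟩ := (Submodule.mem_sSup_of_directed (hne.image _) hdir').1 h
  exact ⟨S, hS, gen_le.2 hx⟩

instance : IsCompactlyGenerated (SubmoduleFunctor X) where
  exists_sSup_eq S := by
    refine ⟨{T | ∃ (V : C) (x : X.obj V), x ∈ S.carrier V ∧ gen x = T}, ?_, le_antisymm ?_ ?_⟩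
    · rintro _ ⟨V, x, -, rfl⟩
      exact isCompactElement_gen x
    · refine sSup_le ?_
      rintro _ ⟨V, x, hx, rfl⟩
      exact gen_le.2 hx
    · intro V x hx
      have h : gen x ≤ sSup {T | ∃ (V : C) (x : X.obj V), x ∈ S.carrier V ∧ gen x = T} :=
        le_sSup ⟨V, x, hx, rfl⟩
      exact gen_le.1 h

/-- The functor underlying a subfunctor. -/
def toFunctor (S : SubmoduleFunctor X) : C ⥤ ModuleCat.{v} K where
  obj V := ModuleCat.of K (S.carrier V)
  map f := ModuleCat.ofHom ((X.map f).hom.restrict fun _ hx => S.map_mem f hx)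
  map_id V := by
    ext x
    change (X.map (𝟙 _)).hom x.1 = x.1
    simp
  map_comp f g := by
    ext x
    change (X.map (f ≫ g)).hom x.1 = (X.map g).hom ((X.map f).hom x.1)
    simp

/-- The inclusion of a subfunctor. -/
def ι (S : SubmoduleFunctor X) : S.toFunctor ⟶ X where
  app V := ModuleCat.ofHom (S.carrier V).subtype

@[simp] lemma ι_app_apply (S : SubmoduleFunctor X) (V : C) (x : S.carrier V) :
    (S.ι.app V).hom x = x.1 := rfl

/-- The range of a morphism as a subfunctor. -/
def range {Y : C ⥤ ModuleCat.{v} K} (f : Y ⟶ X) : SubmoduleFunctor X where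
  carrier V := LinearMap.range (f.app V).hom
  map_mem {V W} g x hx := by
    obtain ⟨y, rfl⟩ := hx
    exact ⟨(Y.map g).hom y, LinearMap.congr_fun
      (congrArg ModuleCat.Hom.hom (f.naturality g)) y⟩

lemma app_apply_congr {Y Z : C ⥤ ModuleCat.{v} K} {f g : Y ⟶ Z} (h : f = g) (V : C)
    (x : Y.obj V) : (f.app V).hom x = (g.app V).hom x := by rw [h]

lemma isIso_of_bijective {Y Z : C ⥤ ModuleCat.{v} K} (f : Y ⟶ Z)
    (h : ∀ V, Function.Bijective (f.app V).hom) : IsIso f := by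
  have : ∀ V, IsIso (f.app V) := fun V =>
    (ConcreteCategory.isIso_iff_bijective (f.app V)).2 (h V)
  exact NatIso.isIso_of_isIso_app f

lemma injective_of_mono {Y Z : C ⥤ ModuleCat.{v} K} (f : Y ⟶ Z) [Mono f] (V : C) :
    Function.Injective (f.app V).hom :=
  (ModuleCat.mono_iff_injective _).1 inferInstance

lemma simple_toFunctor {S : SubmoduleFunctor X} (hS : IsAtom S) : Simple S.toFunctor where
  mono_isIso_iff_nonzero {Y} f _ := by
    constructor
    · rintro hf rfl
      refine hS.1 (eq_bot_iff.2 fun V x hx => ?_)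
      have h1 : (𝟙 S.toFunctor) = 0 := by
        rw [← IsIso.inv_hom_id (0 : Y ⟶ S.toFunctor), comp_zero]
      exact congrArg Subtype.val (app_apply_congr h1 V (⟨x, hx⟩ : S.carrier V))
    · intro hf
      have hle : range (f ≫ S.ι) ≤ S := by
        rintro V _ ⟨y, rfl⟩
        exact ((f.app V).hom y).2
      rcases hS.le_iff.1 hle with h | h
      · refine absurd ?_ hf
        ext V y
        have : ((f ≫ S.ι).app V).hom y ∈ (range (f ≫ S.ι)).carrier V := ⟨y, rfl⟩
        rw [h] at this
        exact Subtype.ext this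
      · refine isIso_of_bijective f fun V => ⟨injective_of_mono f V, fun x => ?_⟩
        have : x.1 ∈ (range (f ≫ S.ι)).carrier V := by rw [h]; exact x.2
        obtain ⟨y, hy⟩ := this
        exact ⟨y, Subtype.ext hy⟩

lemma exists_linearMap_of_iSupIndep {M N : Type*} [AddCommGroup M] [Module K M]
    [AddCommGroup N] [Module K N] {J : Type*} (p : J → Submodule K M) (hp : iSupIndep p)
    (hp' : iSup p = ⊤) (φ : ∀ j, p j →ₗ[K] N) :
    ∃ ψ : M →ₗ[K] N, ∀ j (x : p j), ψ x = φ j x := by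
  classical
  have h := DirectSum.isInternal_submodule_of_iSupIndep_of_iSup_eq_top hp hp'
  let e := LinearEquiv.ofBijective (DirectSum.coeLinearMap p) h
  refine ⟨DirectSum.toModule K J N φ ∘ₗ e.symm.toLinearMap, fun j x => ?_⟩
  have : e.symm x = DirectSum.lof K J (fun j => p j) j x := by
    rw [LinearEquiv.symm_apply_eq]
    exact (DirectSum.coeLinearMap_lof p j x).symm
  simp [this]

lemma linearMap_ext_of_iSup_eq_top {M N : Type*} [AddCommGroup M] [Module K M]
    [AddCommGroup N] [Module K N] {J : Type*} {p : J → Submodule K M}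
    (hp' : iSup p = ⊤) {φ ψ : M →ₗ[K] N} (h : ∀ j, ∀ x ∈ p j, φ x = ψ x) : φ = ψ := by
  have : ⊤ ≤ LinearMap.eqLocus φ ψ := hp' ▸ iSup_le fun j x hx => h j x hx
  exact LinearMap.ext fun x => this trivial

/-- A functor is the coproduct of an independent spanning family of subfunctors. -/
lemma nonempty_isColimit_cofan {J : Type*} (S : J → SubmoduleFunctor X) (hS : iSupIndep S)
    (hS' : iSup S = ⊤) : Nonempty (IsColimit (Cofan.mk X fun j => (S j).ι)) := by
  have hind : ∀ V, iSupIndep fun j => (S j).carrier V := by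
    intro V j
    have := congrArg (fun T => carrier T V) (hS j).eq_bot
    simp only [carrier_inf, carrier_iSup] at this
    exact disjoint_iff.2 this
  have htop : ∀ V, ⨆ j, (S j).carrier V = ⊤ := by
    intro V
    rw [← carrier_iSup, hS', carrier_top]
  have key (s : Cofan fun j => (S j).toFunctor) (V : C) :
      ∃ ψ : X.obj V →ₗ[K] s.pt.obj V, ∀ j (x : (S j).carrier V),
        ψ x = ((s.inj j).app V).hom x :=
    exists_linearMap_of_iSupIndep _ (hind V) (htop V) _
  choose ψ hψ using key
  refine ⟨Cofan.IsColimit.mk _ (fun s => { app V := ModuleCat.ofHom (ψ s V), naturality := ?_ }) ?_ ?_⟩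
  · intro V W f
    ext1
    refine linearMap_ext_of_iSup_eq_top (htop V) fun j x hx => ?_
    have h1 := hψ s W j ⟨(X.map f).hom x, (S j).map_mem f hx⟩
    have h2 := hψ s V j ⟨x, hx⟩
    have h3 := LinearMap.congr_fun
      (congrArg ModuleCat.Hom.hom ((s.inj j).naturality f)) ⟨x, hx⟩
    change ψ s W ((X.map f).hom x) = (s.pt.map f).hom (ψ s V x)
    rw [h1, h2]
    exact h3
  · intro s j
    ext V x
    exact hψ s V j x
  · intro s m hm
    ext V : 2
    ext1
    refine linearMap_ext_of_iSup_eq_top (htop V) fun j x hx => ?_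
    have h1 := hψ s V j ⟨x, hx⟩
    exact (app_apply_congr (hm j) V (⟨x, hx⟩ : (S j).carrier V)).trans h1.symm

end SubmoduleFunctor

open SubmoduleFunctor

/-- A short exact sequence of functors splits if the subfunctors of the middle term are
complemented. -/
lemma nonempty_splitting_of_complementedLattice (S : ShortComplex (C ⥤ ModuleCat.{v} K))
    (hS : S.ShortExact) [ComplementedLattice (SubmoduleFunctor S.X₂)] : Nonempty S.Splitting := by
  have := hS.mono_f
  have := hS.epi_g
  obtain ⟨Z, hZ⟩ := exists_isCompl (range S.f)
  have hexact : ∀ V x, (S.g.app V).hom x = 0 → x ∈ (range S.f).carrier V := by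
    intro V x hx
    have h1 := hS.exact.map ((evaluation C (ModuleCat.{v} K)).obj V)
    exact (ShortComplex.moduleCat_exact_iff _).1 h1 x hx
  -- The complement `Z` meets the kernel of `S.g` trivially and together with it spans `S.X₂`, so it
  -- maps isomorphically to `S.X₃` and yields a section.
  have hiso : IsIso (Z.ι ≫ S.g) := by
    refine isIso_of_bijective _ fun V => ⟨?_, fun y => ?_⟩
    · rw [injective_iff_map_eq_zero]
      intro x hx
      have : x.1 ∈ (range S.f ⊓ Z).carrier V := ⟨hexact V _ hx, x.2⟩
      rw [hZ.inf_eq_bot] at this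
      exact Subtype.ext this
    · obtain ⟨x, rfl⟩ := (ModuleCat.epi_iff_surjective (S.g.app V)).1 inferInstance y
      have : x ∈ (range S.f ⊔ Z).carrier V := by rw [hZ.sup_eq_top]; trivial
      obtain ⟨_, ⟨a, rfl⟩, z, hz, rfl⟩ := Submodule.mem_sup.1 this
      refine ⟨⟨z, hz⟩, ?_⟩
      have h0 : (S.g.app V).hom ((S.f.app V).hom a) = 0 :=
        app_apply_congr S.zero V a
      change (S.g.app V).hom z = (S.g.app V).hom _
      rw [map_add, h0, zero_add]
  exact ⟨ShortComplex.Splitting.ofExactOfSection S hS.exact (inv (Z.ι ≫ S.g) ≫ Z.ι)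
    (by simp) inferInstance⟩

/-- A complemented, modular, compactly generated lattice has an independent set of atoms with
supremum `⊤`. To index it in universe `v`, choose a nonzero element of each atom at some `c n`:
disjoint atoms cannot share one, so the atoms inject into `Σ n, X.obj (c n)`. -/
lemma exists_isColimit_cofan_simple_of_complementedLattice (X : C ⥤ ModuleCat.{v} K)
    [ComplementedLattice (SubmoduleFunctor X)] (c : ℕ → C) (hc : ∀ V, ∃ n, Nonempty (V ≅ c n)) :
    ∃ (J : Type v) (S : J → (C ⥤ ModuleCat.{v} K)) (i : ∀ j, S j ⟶ X),
      (∀ j, Simple (S j)) ∧ Nonempty (IsColimit (Cofan.mk X i)) := by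
  obtain ⟨s, hs, htop, hatom⟩ :=
    exists_sSupIndep_of_sSup_atoms_eq_top (sSup_atoms_eq_top (α := SubmoduleFunctor X))
  have hne : ∀ T : s, ∃ (n : ℕ) (x : X.obj (c n)), x ≠ 0 ∧ x ∈ T.1.carrier (c n) := by
    rintro ⟨T, hT⟩
    by_contra! h
    refine (hatom hT).1 (eq_bot_iff.2 fun V x hx => ?_)
    obtain ⟨n, ⟨e⟩⟩ := hc V
    have h0 : (X.map e.hom).hom x = 0 := by
      by_contra h1
      exact h n _ h1 (T.map_mem _ hx)
    have h2 : (X.map e.inv).hom ((X.map e.hom).hom x) = x := by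
      rw [← LinearMap.comp_apply, ← ModuleCat.hom_comp, ← X.map_comp]
      simp
    rw [carrier_bot, Submodule.mem_bot, ← h2, h0, map_zero]
  choose n x hx0 hx using hne
  have hinj : Function.Injective fun T : s => (⟨n T, x T⟩ : Σ n : ℕ, X.obj (c n)) := by
    intro T T' h
    by_contra hTT
    have hdis : Disjoint T.1 T'.1 := hs.pairwiseDisjoint T.2 T'.2 fun h => hTT (Subtype.ext h)
    have key : ∀ y : Σ n : ℕ, X.obj (c n), y.2 ∈ T.1.carrier (c y.1) →
        y.2 ∈ T'.1.carrier (c y.1) → y.2 = 0 := by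
      intro y h1 h2
      have : y.2 ∈ (T.1 ⊓ T'.1).carrier (c y.1) := ⟨h1, h2⟩
      rwa [hdis.eq_bot] at this
    refine hx0 T (key ⟨n T, x T⟩ (hx T) ?_)
    have h' : (⟨n T, x T⟩ : Σ n : ℕ, X.obj (c n)) = ⟨n T', x T'⟩ := h
    rw [h']
    exact hx T'
  have : Small.{v} s := small_of_injective hinj
  let e := equivShrink.{v} s
  refine ⟨Shrink.{v} s, fun j => (e.symm j).1.toFunctor, fun j => (e.symm j).1.ι,
    fun j => simple_toFunctor (hatom (e.symm j).2), nonempty_isColimit_cofan _ ?_ ?_⟩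
  · exact ((sSupIndep_iff _).1 hs).comp e.symm.injective
  · rw [← htop, sSup_eq_iSup', ← e.symm.surjective.iSup_comp]

end SubmoduleFunctor

/-! ### Primitive parts and complements of subfunctors. -/

section GenericRep

open MonoidAlgebra

variable {F : Type u} [Field F] {K : Type v} [Field K]

namespace GenericRep

/-- The standard vector space of dimension `n`. -/
noncomputable abbrev stdObj (F : Type u) [Field F] (n : ℕ) : FGModuleCat.{u} F :=
  FGModuleCat.of F (Fin n → F)

lemma exists_iso_stdObj (V : FGModuleCat.{u} F) : ∃ n, Nonempty (V ≅ stdObj F n) := by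
  let e : V ≃ₗ[F] (Fin (Module.finrank F V) → F) := LinearEquiv.ofFinrankEq _ _ (by simp)
  exact ⟨_, ⟨e.toFGModuleCatIso⟩⟩

/-- The `K`-linear map induced by a linear map between standard spaces. -/
noncomputable def act (X : GenericRep F K) {m n : ℕ} (f : (Fin m → F) →ₗ[F] (Fin n → F)) :
    X.obj (stdObj F m) →ₗ[K] X.obj (stdObj F n) :=
  (X.map (FGModuleCat.ofHom f)).hom

variable (X : GenericRep F K)

lemma act_comp {l m n : ℕ} (g : (Fin m → F) →ₗ[F] (Fin n → F))
    (f : (Fin l → F) →ₗ[F] (Fin m → F)) (x) : act X (g ∘ₗ f) x = act X g (act X f x) := by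
  have : FGModuleCat.ofHom (g ∘ₗ f) = FGModuleCat.ofHom f ≫ FGModuleCat.ofHom g := rfl
  rw [act, this, X.map_comp]
  rfl

lemma act_id {n : ℕ} (x) : act X (LinearMap.id : (Fin n → F) →ₗ[F] (Fin n → F)) x = x := by
  have : FGModuleCat.ofHom (LinearMap.id : (Fin n → F) →ₗ[F] (Fin n → F)) = 𝟙 _ := rfl
  rw [act, this, X.map_id]
  rfl

/-- The representation of the monoid of endomorphisms of the standard space. -/
noncomputable def endRep (n : ℕ) :
    Representation K (Module.End F (Fin n → F)) (X.obj (stdObj F n)) where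
  toFun f := act X f
  map_one' := LinearMap.ext fun x => act_id X x
  map_mul' f g := LinearMap.ext fun x => act_comp X f g x

lemma asAlgebraHom_single (n : ℕ) (f : Module.End F (Fin n → F)) (x) :
    (endRep X n).asAlgebraHom (single f 1) x = act X f x := by
  simp [endRep]

lemma asAlgebraHom_mem (G : SubmoduleFunctor X) {n : ℕ}
    (a : MonoidAlgebra K (Module.End F (Fin n → F))) {x} (hx : x ∈ G.carrier (stdObj F n)) :
    (endRep X n).asAlgebraHom a x ∈ G.carrier (stdObj F n) := by
  induction a using MonoidAlgebra.induction_linear with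
  | zero => simp
  | add a b ha hb => rw [map_add]; exact Submodule.add_mem _ ha hb
  | single f c =>
    rw [Representation.asAlgebraHom_single]
    exact Submodule.smul_mem _ _ (G.map_mem _ hx)

lemma asAlgebraHom_mem_subrepresentation {n : ℕ} (T : Subrepresentation (endRep X n))
    (a : MonoidAlgebra K (Module.End F (Fin n → F))) {x} (hx : x ∈ T.toSubmodule) :
    (endRep X n).asAlgebraHom a x ∈ T.toSubmodule := by
  induction a using MonoidAlgebra.induction_linear with
  | zero => simp
  | add a b ha hb => rw [map_add]; exact Submodule.add_mem _ ha hb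
  | single f c =>
    rw [Representation.asAlgebraHom_single]
    exact Submodule.smul_mem _ _ (T.apply_mem_toSubmodule _ hx)

lemma asAlgebraHom_mem_of_mem_rankIdeal (G : SubmoduleFunctor X) {n r : ℕ} {x}
    (hx : ∀ f : Module.End F (Fin n → F), Module.finrank F (LinearMap.range f) < r →
      act X f x ∈ G.carrier (stdObj F n))
    {a : MonoidAlgebra K (Module.End F (Fin n → F))} (ha : a ∈ rankIdeal K F (Fin n → F) r) :
    (endRep X n).asAlgebraHom a x ∈ G.carrier (stdObj F n) := by
  induction ha using Submodule.span_induction with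
  | mem a ha =>
    obtain ⟨f, hf, rfl⟩ := ha
    rw [asAlgebraHom_single]
    exact hx f hf
  | zero => simp
  | add a b _ _ ha hb => rw [map_add]; exact Submodule.add_mem _ ha hb
  | smul c a _ ha =>
    rw [smul_eq_mul, map_mul]
    exact asAlgebraHom_mem X G c ha

lemma exists_factorization {n : ℕ} (f : Module.End F (Fin n → F)) :
    ∃ (g : (Fin (Module.finrank F (LinearMap.range f)) → F) →ₗ[F] (Fin n → F))
      (h : (Fin n → F) →ₗ[F] (Fin (Module.finrank F (LinearMap.range f)) → F)), g ∘ₗ h = f := by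
  let e : LinearMap.range f ≃ₗ[F] (Fin (Module.finrank F (LinearMap.range f)) → F) :=
    LinearEquiv.ofFinrankEq _ _ (by simp)
  refine ⟨(LinearMap.range f).subtype ∘ₗ e.symm.toLinearMap, e.toLinearMap ∘ₗ f.rangeRestrict, ?_⟩
  ext; simp

lemma le_of_stdObj {G H : SubmoduleFunctor X}
    (h : ∀ n, G.carrier (stdObj F n) ≤ H.carrier (stdObj F n)) : G ≤ H := by
  intro V x hx
  obtain ⟨n, ⟨e⟩⟩ := exists_iso_stdObj V
  have h2 : (X.map e.inv).hom ((X.map e.hom).hom x) = x := by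
    rw [← LinearMap.comp_apply, ← ModuleCat.hom_comp, ← X.map_comp]
    simp
  rw [← h2]
  exact H.map_mem _ (h n (G.map_mem _ hx))

variable [Finite F] [CharZero K]

/-- The action of Kovács' idempotent, which annihilates the singular endomorphisms. -/
noncomputable def primitivePart (n : ℕ) : X.obj (stdObj F n) →ₗ[K] X.obj (stdObj F n) :=
  (endRep X n).asAlgebraHom (1 - (exists_one_sub_annihilates_singular K F (Fin n → F)).choose)

lemma primitivePart_act {n : ℕ} {f : Module.End F (Fin n → F)}
    (hf : Module.finrank F (LinearMap.range f) < n) (x) :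
    primitivePart X n (act X f x) = 0 := by
  have h := ((exists_one_sub_annihilates_singular K F (Fin n → F)).choose_spec.2 f (by simpa)).1
  rw [← asAlgebraHom_single, primitivePart, ← Module.End.mul_apply, ← map_mul, h, map_zero,
    LinearMap.zero_apply]

lemma act_primitivePart {n : ℕ} {f : Module.End F (Fin n → F)}
    (hf : Module.finrank F (LinearMap.range f) < n) (x) :
    act X f (primitivePart X n x) = 0 := by
  have h := ((exists_one_sub_annihilates_singular K F (Fin n → F)).choose_spec.2 f (by simpa)).2
  rw [← asAlgebraHom_single, primitivePart, ← Module.End.mul_apply, ← map_mul, h, map_zero,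
    LinearMap.zero_apply]

/-- Inclusions of subfunctors can be tested on primitive parts. -/
lemma le_of_primitivePart_mem {G H : SubmoduleFunctor X}
    (h : ∀ n, ∀ x ∈ G.carrier (stdObj F n), primitivePart X n x ∈ H.carrier (stdObj F n)) :
    G ≤ H := by
  refine le_of_stdObj X fun n => ?_
  induction n using Nat.strong_induction_on with
  | _ n ih =>
    intro x hx
    have he := (exists_one_sub_annihilates_singular K F (Fin n → F)).choose_spec.1
    set e := (exists_one_sub_annihilates_singular K F (Fin n → F)).choose with hedef
    have h1 : x = primitivePart X n x + (endRep X n).asAlgebraHom e x := by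
      rw [primitivePart, ← hedef, map_sub, map_one]
      simp
    rw [h1]
    refine Submodule.add_mem _ (h n x hx) (asAlgebraHom_mem_of_mem_rankIdeal X H (fun f hf => ?_) he)
    -- A singular `f` factors through a standard space of smaller dimension, where the induction
    -- hypothesis applies.
    obtain ⟨g, k, hgk⟩ := exists_factorization f
    rw [← hgk, act_comp]
    exact H.map_mem _ (ih _ (by simpa using hf) (G.map_mem _ hx))

/-- If `f` is not surjective, an idempotent of the same rank fixing it on the left is singular and
dies under `primitivePart X m`; if `f` is not injective, one fixing it on the right kills the inner
primitive part. Only automorphisms remain, and these preserve `T n`. -/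
lemma primitivePart_act_primitivePart_mem (T : ∀ n, Subrepresentation (endRep X n)) {m n : ℕ}
    (f : (Fin n → F) →ₗ[F] (Fin m → F)) {x} (hx : x ∈ (T n).toSubmodule) :
    primitivePart X m (act X f (primitivePart X n x)) ∈ (T m).toSubmodule := by
  by_cases hinj : Function.Injective f
  · by_cases hsurj : Function.Surjective f
    · obtain rfl : n = m := by
        simpa using (LinearEquiv.ofBijective f ⟨hinj, hsurj⟩).finrank_eq
      exact asAlgebraHom_mem_subrepresentation X _ _ ((T n).apply_mem_toSubmodule f
        (asAlgebraHom_mem_subrepresentation X _ _ hx))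
    · obtain ⟨p, -, hpf, hp⟩ := exists_idempotent_comp_eq f
      have hlt : Module.finrank F (LinearMap.range p) < m := by
        have := Submodule.finrank_lt (mt LinearMap.range_eq_top.1 hsurj)
        rw [hp]
        simpa using this
      rw [← hpf, act_comp, primitivePart_act X hlt]
      exact Submodule.zero_mem _
  · obtain ⟨p, -, hpf, hp⟩ := exists_comp_idempotent_eq f
    have hlt : Module.finrank F (LinearMap.range p) < n := by
      have h1 := f.finrank_range_add_finrank_ker
      have h2 : Module.finrank F (LinearMap.ker f) ≠ 0 := fun h0 =>
        hinj (LinearMap.ker_eq_bot.1 (Submodule.finrank_eq_zero.1 h0))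
      rw [Module.finrank_fin_fun] at h1
      omega
    rw [← hpf, act_comp, act_primitivePart X hlt, map_zero, map_zero]
    exact Submodule.zero_mem _

/-- The subfunctor of the elements all of whose images have primitive parts in the given
subrepresentations. -/
noncomputable def primitiveCore (T : ∀ n, Subrepresentation (endRep X n)) :
    SubmoduleFunctor X where
  carrier V := ⨅ (n : ℕ) (f : V ⟶ stdObj F n),
    (T n).toSubmodule.comap (primitivePart X n ∘ₗ (X.map f).hom)
  map_mem {V W} g x hx := by
    simp only [Submodule.mem_iInf] at hx ⊢
    intro n f
    simpa using hx n (g ≫ f)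

/-- Choose `T n` complementary to `Y` at `F^n` among subrepresentations of `End (F^n)`. Primitive
parts of elements of `Y ⊓ primitiveCore X T` lie in `Y` and in `T n`, hence vanish; conversely, if
`x = y + t`, then the primitive part of `t` lies in the core by
`primitivePart_act_primitivePart_mem`. -/
instance complementedLattice_submoduleFunctor : ComplementedLattice (SubmoduleFunctor X) where
  exists_isCompl Y := by
    have hT : ∀ n, ∃ T : Subrepresentation (endRep X n),
        IsCompl (⟨Y.carrier (stdObj F n), fun f _ hx => Y.map_mem _ hx⟩) T := by
      intro n
      have := isSemisimpleRing_monoidAlgebra_end K F (Fin n → F)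
      have : ComplementedLattice (Subrepresentation (endRep X n)) :=
        Subrepresentation.subrepresentationSubmoduleOrderIso.symm.complementedLattice
      exact exists_isCompl _
    choose T hT using hT
    refine ⟨primitiveCore X T, disjoint_iff_inf_le.2 ?_, codisjoint_iff_le_sup.2 ?_⟩
    · refine le_of_primitivePart_mem X fun n x hx => ?_
      have h1 : primitivePart X n x ∈ (T n).toSubmodule := by
        have h0 : x ∈ (primitiveCore X T).carrier (stdObj F n) := hx.2
        simp only [primitiveCore, Submodule.mem_iInf] at h0
        simpa using h0 n (𝟙 _)
      have h2 : primitivePart X n x ∈ Y.carrier (stdObj F n) := asAlgebraHom_mem X Y _ hx.1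
      have h3 := (hT n).disjoint.le_bot
      exact h3 ⟨h2, h1⟩
    · refine le_of_primitivePart_mem X fun n x _ => ?_
      have h3 := (hT n).codisjoint.top_le
      obtain ⟨y, hy, t, ht, rfl⟩ := Submodule.mem_sup.1 (h3 (Submodule.mem_top : x ∈ ⊤))
      rw [map_add]
      refine Submodule.add_mem_sup (asAlgebraHom_mem X Y _ hy) ?_
      simp only [primitiveCore, Submodule.mem_iInf]
      exact fun m f => primitivePart_act_primitivePart_mem X T f.hom.hom ht

end GenericRep

end GenericRep

theorem corollary1p3 (F : Type u) [Field F] [Finite F] (K : Type v) [Field K] [CharZero K] :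
    IsSemisimpleCategory.{v} (GenericRep F K) where
  exists_isColimit_cofan_simple X :=
    exists_isColimit_cofan_simple_of_complementedLattice X (GenericRep.stdObj F)
      GenericRep.exists_iso_stdObj
  nonempty_splitting S hS := nonempty_splitting_of_complementedLattice S hS
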